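/- All graphs are finite and simple. A graph is $3$-connected if it has at least $4$ vertices and remains connected whenever fewer than $3$ vertices are removed. An edge cut of a graph $G$ is a set consisting of all edges with one end in $S$ and the other end in $V(G)\setminus S$, for some nonempty proper subset $S$ of $V(G)$; a bond of $G$ is an inclusion-minimal nonempty edge cut. **Theorem 1.4.** Let $G$ be a $3$-connected graph with $n$ vertices and $m$ edges. Let $c(G)$ be the length of a longest cycle of $G$ and let $c^*(G)$ be the number of edges of a largest bond of $G$. Suppose that at least one of the following holds: 1. $c(G)\ge n-3$; 2. $c^*(G)\ge m-n-1$. Then every longest cycle of $G$ and every largest bond of $G$ have at least one edge in common. -/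

import Mathlib

namespace SimpleGraph

/-- A finite graph is `k`-connected if it has at least `k + 1` vertices and remains connected
whenever fewer than `k` vertices are removed. -/
def IsKConnected {V : Type*} [Fintype V] (G : SimpleGraph V) (k : ℕ) : Prop :=
  k + 1 ≤ Fintype.card V ∧
    ∀ S : Finset V, S.card < k → (G.induce {v : V | v ∉ S}).Connected

/-- The circumference `c(G)`: the supremum of the lengths of the cycles of `G`
(for a finite graph with at least one cycle, this is the length of a longest cycle). -/
noncomputable def circumference {V : Type*} (G : SimpleGraph V) : ℕ :=
  sSup {l : ℕ | ∃ (u : V) (C : G.Walk u u), C.IsCycle ∧ C.length = l}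

/-- A longest cycle: a cycle whose length is at least that of every cycle of the graph. -/
def IsLongestCycle {V : Type*} (G : SimpleGraph V) {u : V} (C : G.Walk u u) : Prop :=
  C.IsCycle ∧ ∀ (v : V) (D : G.Walk v v), D.IsCycle → D.length ≤ C.length

/-- The edge cut `[S, V \ S]`: all edges of `G` with one end in `S` and the other outside `S`. -/
def edgeCut {V : Type*} (G : SimpleGraph V) (S : Set V) : Set (Sym2 V) :=
  {e | ∃ x y : V, G.Adj x y ∧ x ∈ S ∧ y ∉ S ∧ e = s(x, y)}

/-- A set of edges is an edge cut if it is `[S, V \ S]` for a nonempty proper subset `S` of the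
vertex set. -/
def IsEdgeCut {V : Type*} (G : SimpleGraph V) (B : Set (Sym2 V)) : Prop :=
  ∃ S : Set V, S.Nonempty ∧ Sᶜ.Nonempty ∧ B = G.edgeCut S

/-- A bond is an inclusion-minimal nonempty edge cut. -/
def IsBond {V : Type*} (G : SimpleGraph V) (B : Set (Sym2 V)) : Prop :=
  Minimal (fun A : Set (Sym2 V) => A.Nonempty ∧ G.IsEdgeCut A) B

/-- `c*(G)`: the supremum of the numbers of edges of the bonds of `G`
(for a finite graph with at least one bond, this is the size of a largest bond). -/
noncomputable def maxBondSize {V : Type*} (G : SimpleGraph V) : ℕ :=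
  sSup {l : ℕ | ∃ B : Set (Sym2 V), G.IsBond B ∧ B.ncard = l}

/-- A largest bond: a bond with at least as many edges as every bond of the graph. -/
def IsLargestBond {V : Type*} (G : SimpleGraph V) (B : Set (Sym2 V)) : Prop :=
  G.IsBond B ∧ ∀ A : Set (Sym2 V), G.IsBond A → A.ncard ≤ B.ncard

end SimpleGraph

/-! Suppose a longest cycle `C` and a largest bond share no edge. The bond is the cut of a partition
into two connected sides, so `C` lies in one side and misses the other, `T`. Two maximality
principles now clash. A connected set off `C` is never attached to two consecutive cycle vertices,
and cycle vertices two steps apart can only be attached to it at one common vertex (`detour_le`).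
Moving a set from `Tᶜ` to `T`, with both sides still connected, gains no edges (`pairs_move_le`).

If `c(G) ≥ n - 3`, then `T` has two or three vertices and at most one other vertex is off `C`.
Moving a suitable cycle vertex attached to `T` together with its successor, which has no neighbour
in `T`, shows that the former has more neighbours in `T` than in `Tᶜ`, hence at least three
(`nbrs_lt_nbrs_of_connOn`). So `|T| = 3`, and moving the next cycle vertex as well gives a
contradiction (`four_le_card_of_compl_eq_cycle`).

If `c*(G) ≥ m - n - 1`, the two sides span at most `n + 1` edges. Let `K` be the component of `G -
C` containing `T`, and `Y` the set of cycle vertices attached to it. Minimum degree three gives `|V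
\ K| ≤ |Y| + 4` (`card_compl_le_card_attachments_add`). As `Y` has no consecutive members, all its
gaps but at most one equal two. Then every attachment sees the same single vertex of `K`, which is a
cut vertex because `|K| ≥ 2`. -/

namespace SimpleGraph

/-! ### Connected sets, edge counts, and bonds as partitions into connected sides. -/

section Basics

open scoped Classical
open Finset

variable {V : Type*} {G : SimpleGraph V}

/-- The finite set `X` is nonempty and any two of its vertices are joined by a walk inside `X`. -/
def ConnOn (G : SimpleGraph V) (X : Finset V) : Prop :=
  X.Nonempty ∧ ∀ a ∈ X, ∀ b ∈ X, ∃ p : G.Walk a b, ∀ v ∈ p.support, v ∈ X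

/-- The number of neighbours of `v` in `X`. -/
noncomputable def nbrs (G : SimpleGraph V) (v : V) (X : Finset V) : ℕ :=
  ∑ y ∈ X, if G.Adj v y then 1 else 0

/-- The number of ordered adjacent pairs in `X ×ˢ Y`. -/
noncomputable def pairs (G : SimpleGraph V) (X Y : Finset V) : ℕ :=
  ∑ v ∈ X, G.nbrs v Y

theorem nbrs_eq_card (v : V) (X : Finset V) : G.nbrs v X = #{y ∈ X | G.Adj v y} := by
  simp [nbrs]

theorem nbrs_pos {v : V} {X : Finset V} : 0 < G.nbrs v X ↔ ∃ y ∈ X, G.Adj v y := by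
  simp [nbrs_eq_card, Finset.card_pos, Finset.Nonempty]

theorem nbrs_eq_zero {v : V} {X : Finset V} : G.nbrs v X = 0 ↔ ∀ y ∈ X, ¬ G.Adj v y := by
  have := nbrs_pos (G := G) (v := v) (X := X)
  constructor
  · intro h y hy hv
    have := this.2 ⟨y, hy, hv⟩
    omega
  · intro h
    by_contra h0
    obtain ⟨y, hy, hv⟩ := this.1 (Nat.pos_of_ne_zero h0)
    exact h y hy hv

theorem nbrs_le_card (v : V) (X : Finset V) : G.nbrs v X ≤ #X := by
  rw [nbrs_eq_card]; exact Finset.card_filter_le _ _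

theorem nbrs_sdiff {v : V} {X Y : Finset V} (h : Y ⊆ X) :
    G.nbrs v (X \ Y) + G.nbrs v Y = G.nbrs v X :=
  Finset.sum_sdiff h

theorem two_le_nbrs {v a b : V} {X : Finset V} (ha : a ∈ X) (hb : b ∈ X) (hab : a ≠ b)
    (hva : G.Adj v a) (hvb : G.Adj v b) : 2 ≤ G.nbrs v X := by
  rw [nbrs_eq_card, ← Finset.card_pair hab]
  apply Finset.card_le_card
  intro x hx
  simp only [Finset.mem_insert, Finset.mem_singleton] at hx
  rcases hx with rfl | rfl <;> simp [*]

theorem three_le_nbrs {v a b c : V} {X : Finset V} (ha : a ∈ X) (hb : b ∈ X) (hc : c ∈ X)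
    (hab : a ≠ b) (hac : a ≠ c) (hbc : b ≠ c)
    (hva : G.Adj v a) (hvb : G.Adj v b) (hvc : G.Adj v c) : 3 ≤ G.nbrs v X := by
  have : #({a, b, c} : Finset V) = 3 := by
    rw [Finset.card_eq_three]; exact ⟨a, b, c, hab, hac, hbc, rfl⟩
  rw [nbrs_eq_card, ← this]
  apply Finset.card_le_card
  intro x hx
  simp only [Finset.mem_insert, Finset.mem_singleton] at hx
  rcases hx with rfl | rfl | rfl <;> simp [*]

theorem pairs_comm (X Y : Finset V) : G.pairs X Y = G.pairs Y X := by
  unfold pairs nbrs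
  rw [Finset.sum_comm]
  simp_rw [G.adj_comm]

theorem pairs_union_left {X Y Z : Finset V} (h : Disjoint X Y) :
    G.pairs (X ∪ Y) Z = G.pairs X Z + G.pairs Y Z :=
  Finset.sum_union h

theorem pairs_union_right {X Y Z : Finset V} (h : Disjoint X Y) :
    G.pairs Z (X ∪ Y) = G.pairs Z X + G.pairs Z Y := by
  rw [pairs_comm, pairs_union_left h, pairs_comm X, pairs_comm Y]

theorem pairs_singleton (v : V) (X : Finset V) : G.pairs {v} X = G.nbrs v X := by
  simp [pairs]

theorem pairs_insert_insert {X : Finset V} {z : V} (hz : z ∉ X) :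
    G.pairs (insert z X) (insert z X) = G.pairs X X + 2 * G.nbrs z X := by
  have hd : Disjoint {z} X := by simpa using hz
  have h0 : G.nbrs z {z} = 0 := by simp [nbrs]
  rw [Finset.insert_eq, pairs_union_left hd, pairs_union_right hd, pairs_union_right hd,
    pairs_comm X {z}, pairs_singleton, pairs_singleton, h0]
  ring

theorem ConnOn.exists_adj {X A : Finset V} (h : G.ConnOn X) {a b : V} (ha : a ∈ X) (haA : a ∈ A)
    (hb : b ∈ X) (hbA : b ∉ A) : ∃ x ∈ X, ∃ y ∈ X, x ∈ A ∧ y ∉ A ∧ G.Adj x y := by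
  obtain ⟨p, hp⟩ := h.2 a ha b hb
  obtain ⟨d, hd, h1, h2⟩ := p.exists_boundary_dart (A : Set V) (by simpa using haA)
    (by simpa using hbA)
  exact ⟨d.fst, hp _ (p.dart_fst_mem_support_of_mem_darts hd), d.snd,
    hp _ (p.dart_snd_mem_support_of_mem_darts hd), by simpa using h1, by simpa using h2, d.adj⟩

theorem ConnOn.exists_path {X : Finset V} (h : G.ConnOn X) {a b : V} (ha : a ∈ X) (hb : b ∈ X) :
    ∃ p : G.Walk a b, p.IsPath ∧ ∀ v ∈ p.support, v ∈ X := by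
  obtain ⟨p, hp⟩ := h.2 a ha b hb
  exact ⟨p.bypass, p.bypass_isPath, fun v hv => hp v (p.support_bypass_subset_support hv)⟩

theorem connOn_singleton (v : V) : G.ConnOn {v} := by
  refine ⟨by simp, ?_⟩
  intro a ha b hb
  simp only [Finset.mem_singleton] at ha hb
  subst ha; subst hb
  exact ⟨Walk.nil, by simp⟩

theorem ConnOn.insert_adj {X : Finset V} (h : G.ConnOn X) {x z : V} (hx : x ∈ X) (hxz : G.Adj x z) :
    G.ConnOn (insert z X) := by
  refine ⟨by simp, ?_⟩
  have key : ∀ a ∈ X, ∃ p : G.Walk a z, ∀ v ∈ p.support, v ∈ insert z X := by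
    intro a ha
    obtain ⟨p, hp⟩ := h.2 a ha x hx
    refine ⟨p.append (Walk.cons hxz Walk.nil), ?_⟩
    intro v hv
    rw [Walk.mem_support_append_iff] at hv
    rcases hv with hv | hv
    · exact Finset.mem_insert_of_mem (hp v hv)
    · simp only [Walk.support_cons, Walk.support_nil, List.mem_cons, List.not_mem_nil,
        or_false] at hv
      rcases hv with rfl | rfl <;> simp [hx]
  intro a ha b hb
  rcases Finset.mem_insert.1 ha with ha' | ha'
  · subst ha'
    rcases Finset.mem_insert.1 hb with hb' | hb'
    · subst hb'
      exact ⟨Walk.nil, by simp⟩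
    · obtain ⟨p, hp⟩ := key b hb'
      exact ⟨p.reverse, by simpa using hp⟩
  · rcases Finset.mem_insert.1 hb with hb' | hb'
    · subst hb'
      exact key a ha'
    · obtain ⟨p, hp⟩ := h.2 a ha' b hb'
      exact ⟨p, fun v hv => Finset.mem_insert_of_mem (hp v hv)⟩

theorem connOn_of_walk {X : Finset V} {a b : V} (p : G.Walk a b)
    (hp : ∀ v, v ∈ p.support ↔ v ∈ X) : G.ConnOn X := by
  refine ⟨⟨a, (hp a).1 p.start_mem_support⟩, ?_⟩
  have key : ∀ x ∈ X, ∃ q : G.Walk a x, ∀ v ∈ q.support, v ∈ X := by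
    intro x hx
    exact ⟨p.takeUntil x ((hp x).2 hx), fun v hv =>
      (hp v).1 (p.support_takeUntil_subset_support _ hv)⟩
  intro x hx y hy
  obtain ⟨q, hq⟩ := key x hx
  obtain ⟨r, hr⟩ := key y hy
  refine ⟨q.reverse.append r, fun v hv => ?_⟩
  rw [Walk.mem_support_append_iff] at hv
  rcases hv with hv | hv
  · exact hq v (by simpa using hv)
  · exact hr v hv

theorem connOn_of_induce {X : Finset V} {s : Set V} (hs : ∀ v, v ∈ s ↔ v ∈ X)
    (h : (G.induce s).Connected) : G.ConnOn X := by
  refine ⟨?_, ?_⟩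
  · obtain ⟨v⟩ := h.nonempty
    exact ⟨v, (hs _).1 v.2⟩
  · intro a ha b hb
    have key : ∀ (x y : s) (_ : (G.induce s).Walk x y),
        ∃ q : G.Walk (x : V) (y : V), ∀ v ∈ q.support, v ∈ X := by
      intro x y p
      induction p with
      | @nil x => exact ⟨Walk.nil, by simpa using (hs _).1 x.2⟩
      | @cons x y z hxy p ih =>
        obtain ⟨q, hq⟩ := ih
        refine ⟨Walk.cons (induce_adj.1 hxy) q, ?_⟩
        intro v hv
        rw [Walk.support_cons, List.mem_cons] at hv
        rcases hv with rfl | hv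
        · exact (hs _).1 x.2
        · exact hq v hv
    obtain ⟨p⟩ := h.preconnected ⟨a, (hs a).2 ha⟩ ⟨b, (hs b).2 hb⟩
    exact key _ _ p

/-- Growing a set inside a connected set adds at least one edge per added vertex. -/
theorem ConnOn.pairs_ge {S R : Finset V} (hS : G.ConnOn S) (hR : R.Nonempty) (hRS : R ⊆ S) :
    G.pairs R R + 2 * #S ≤ G.pairs S S + 2 * #R := by
  induction hn : #(S \ R) generalizing R with
  | zero =>
    have : S ⊆ R := by simpa [Finset.card_eq_zero, Finset.sdiff_eq_empty_iff_subset] using hn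
    rw [Finset.Subset.antisymm hRS this]
  | succ n ih =>
    have hne : (S \ R).Nonempty := by rw [← Finset.card_pos]; omega
    obtain ⟨b, hb⟩ := hne
    obtain ⟨a, ha⟩ := hR
    rw [Finset.mem_sdiff] at hb
    obtain ⟨x, hx, z, hz, hxR, hzR, hxz⟩ := hS.exists_adj (hRS ha) ha hb.1 hb.2
    have h1 := ih (R := insert z R) (by simp) (Finset.insert_subset hz hRS) (by
      rw [Finset.sdiff_insert, Finset.card_erase_of_mem (by simp [hz, hzR])]; omega)
    rw [pairs_insert_insert hzR, Finset.card_insert_of_notMem hzR] at h1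
    have : 0 < G.nbrs z R := nbrs_pos.2 ⟨x, hxR, hxz.symm⟩
    omega

theorem edgeCut_compl (S : Set V) : G.edgeCut Sᶜ = G.edgeCut S := by
  ext e
  simp only [edgeCut, Set.mem_ofPred_eq, Set.mem_compl_iff, not_not]
  constructor <;>
  · rintro ⟨x, y, hxy, hx, hy, rfl⟩
    exact ⟨y, x, hxy.symm, hy, hx, Sym2.eq_swap⟩

theorem mk_mem_edgeCut {S : Set V} {x y : V} :
    s(x, y) ∈ G.edgeCut S ↔ G.Adj x y ∧ (x ∈ S ∧ y ∉ S ∨ x ∉ S ∧ y ∈ S) := by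
  simp only [edgeCut, Set.mem_ofPred_eq]
  constructor
  · rintro ⟨a, b, hab, ha, hb, h⟩
    rw [Sym2.eq_iff] at h
    rcases h with ⟨rfl, rfl⟩ | ⟨rfl, rfl⟩
    · exact ⟨hab, Or.inl ⟨ha, hb⟩⟩
    · exact ⟨hab.symm, Or.inr ⟨hb, ha⟩⟩
  · rintro ⟨h, ⟨hx, hy⟩ | ⟨hx, hy⟩⟩
    · exact ⟨x, y, h, hx, hy, rfl⟩
    · exact ⟨y, x, h.symm, hy, hx, Sym2.eq_swap⟩

section Fintype

variable [Fintype V]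

theorem ncard_edgeCut (S : Finset V) : (G.edgeCut (S : Set V)).ncard = G.pairs S Sᶜ := by
  have h1 : G.pairs S Sᶜ = #{q ∈ S ×ˢ Sᶜ | G.Adj q.1 q.2} := by
    rw [Finset.card_filter, Finset.sum_product]; rfl
  have h2 : G.edgeCut (S : Set V) =
      (({q ∈ S ×ˢ Sᶜ | G.Adj q.1 q.2} : Finset (V × V)).image (fun q => s(q.1, q.2)) :
        Finset (Sym2 V)) := by
    ext e
    simp only [edgeCut, Set.mem_ofPred_eq, Finset.coe_image, Set.mem_image, Finset.mem_coe,
      Finset.mem_filter, Finset.mem_product, Finset.mem_compl, Prod.exists]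
    constructor
    · rintro ⟨x, y, hxy, hx, hy, rfl⟩
      exact ⟨x, y, ⟨⟨hx, hy⟩, hxy⟩, rfl⟩
    · rintro ⟨x, y, ⟨⟨hx, hy⟩, hxy⟩, rfl⟩
      exact ⟨x, y, hxy, hx, hy, rfl⟩
  rw [h1, h2, Set.ncard_coe_finset, Finset.card_image_of_injOn]
  rintro ⟨a, b⟩ hab ⟨c, d⟩ hcd h
  simp only [Finset.coe_filter, Finset.mem_product, Finset.mem_compl, Set.mem_ofPred_eq] at hab hcd
  rw [Sym2.eq_iff] at h
  rcases h with ⟨rfl, rfl⟩ | ⟨rfl, rfl⟩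
  · rfl
  · exact absurd hab.1.1 hcd.1.2

theorem two_mul_ncard_edgeSet : 2 * G.edgeSet.ncard = G.pairs univ univ := by
  have h := G.sum_degrees_eq_twice_card_edges
  rw [← coe_edgeFinset, Set.ncard_coe_finset, ← h]
  unfold pairs
  refine Finset.sum_congr rfl fun v _ => ?_
  rw [nbrs_eq_card, ← card_neighborFinset_eq_degree, neighborFinset_eq_filter]

theorem edgeCut_nonempty (hG : G.ConnOn univ) {S : Set V} (h1 : S.Nonempty) (h2 : Sᶜ.Nonempty) :
    (G.edgeCut S).Nonempty := by
  obtain ⟨a, ha⟩ := h1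
  obtain ⟨b, hb⟩ := h2
  obtain ⟨x, -, y, -, hx, hy, hxy⟩ := hG.exists_adj (A := S.toFinset) (mem_univ a)
    (by simpa using ha) (mem_univ b) (by simpa using hb)
  exact ⟨s(x, y), mk_mem_edgeCut.2 ⟨hxy, Or.inl ⟨by simpa using hx, by simpa using hy⟩⟩⟩

theorem isBond_edgeCut (hG : G.ConnOn univ) {S : Finset V} (h1 : G.ConnOn S) (h2 : G.ConnOn Sᶜ) :
    G.IsBond (G.edgeCut (S : Set V)) := by
  have hne1 : (S : Set V).Nonempty := by exact_mod_cast h1.1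
  have hne2 : (S : Set V)ᶜ.Nonempty := by exact_mod_cast h2.1
  refine ⟨⟨edgeCut_nonempty hG hne1 hne2, _, hne1, hne2, rfl⟩, ?_⟩
  rintro A ⟨hA, W, hW1, hW2, rfl⟩ hsub
  -- no edge inside a connected side crosses `W`, so each side is on one side of `W`
  have side : ∀ X : Finset V, G.ConnOn X → (X = S ∨ X = Sᶜ) → ∀ a ∈ X, ∀ b ∈ X, a ∈ W → b ∈ W := by
    intro X hX hXS a ha b hb haW
    by_contra hbW
    obtain ⟨x, hx, y, hy, hxW, hyW, hxy⟩ := hX.exists_adj (A := W.toFinset) ha (by simpa using haW)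
      hb (by simpa using hbW)
    have := hsub (mk_mem_edgeCut.2 ⟨hxy, Or.inl ⟨by simpa using hxW, by simpa using hyW⟩⟩)
    rw [mk_mem_edgeCut] at this
    rcases hXS with rfl | rfl <;> simp_all
  obtain ⟨e, x, y, hxy, hxW, hyW, rfl⟩ := hA
  have hxyS := hsub (mk_mem_edgeCut.2 ⟨hxy, Or.inl ⟨hxW, hyW⟩⟩)
  rw [mk_mem_edgeCut] at hxyS
  have s1 := side S h1 (Or.inl rfl)
  have s2 := side Sᶜ h2 (Or.inr rfl)
  simp only [Finset.mem_coe, Finset.mem_compl] at *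
  rcases hxyS.2 with ⟨hx, hy⟩ | ⟨hx, hy⟩
  · have : W = S := by
      ext v
      constructor
      · intro hv
        by_contra hvS
        exact hyW (s2 v hvS y hy hv)
      · intro hv
        exact s1 x hx v hv hxW
    rw [this]
  · have : W = (S : Set V)ᶜ := by
      ext v
      constructor
      · intro hv hvS
        exact hyW (s1 v hvS y hy hv)
      · intro hv
        exact s2 x hx v hv hxW
    rw [this, edgeCut_compl]

/-- A side of a minimal edge cut is connected. -/
theorem IsBond.connOn_side (hG : G.ConnOn univ) {S : Finset V}
    (hB : G.IsBond (G.edgeCut (S : Set V))) (hS : S.Nonempty) (hSc : Sᶜ.Nonempty) :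
    G.ConnOn S := by
  refine ⟨hS, ?_⟩
  intro a ha b hb
  by_contra hno
  -- `A` is the component of `a` inside `S`. Its cut lies in that of `S`, properly so, since `S \ A`
  -- also sends an edge out of `S`.
  set A : Finset V := {v ∈ S | ∃ p : G.Walk a v, ∀ w ∈ p.support, w ∈ S} with hA
  have haA : a ∈ A := by
    simp only [hA, Finset.mem_filter]
    exact ⟨ha, Walk.nil, by simpa using ha⟩
  have hbA : b ∉ A := fun h => hno (Finset.mem_filter.1 h).2
  have hAS : ∀ v ∈ A, v ∈ S := fun v hv => (Finset.mem_filter.1 hv).1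
  have hclosed : ∀ v ∈ A, ∀ w, G.Adj v w → w ∈ S → w ∈ A := by
    intro v hv w hvw hw
    obtain ⟨hvS, p, hp⟩ := Finset.mem_filter.1 hv
    refine Finset.mem_filter.2 ⟨hw, p.append (Walk.cons hvw Walk.nil), ?_⟩
    intro u hu
    rw [Walk.mem_support_append_iff] at hu
    rcases hu with hu | hu
    · exact hp u hu
    · simp only [Walk.support_cons, Walk.support_nil, List.mem_cons, List.not_mem_nil,
        or_false] at hu
      rcases hu with rfl | rfl <;> assumption
  have hA1 : (A : Set V).Nonempty := ⟨a, by simpa using haA⟩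
  have hA2 : (A : Set V)ᶜ.Nonempty := ⟨b, by simpa using hbA⟩
  have hsub : G.edgeCut (A : Set V) ≤ G.edgeCut (S : Set V) := by
    rintro e ⟨x, y, hxy, hx, hy, rfl⟩
    exact ⟨x, y, hxy, by simpa using hAS x (by simpa using hx),
      fun h => hy (by simpa using hclosed x (by simpa using hx) y hxy (by simpa using h)), rfl⟩
  have hle := hB.2 ⟨edgeCut_nonempty hG hA1 hA2, _, hA1, hA2, rfl⟩ hsub
  obtain ⟨c, hc⟩ := hSc
  obtain ⟨x, -, y, -, hx, hy, hxy⟩ := hG.exists_adj (A := S \ A) (mem_univ b)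
    (by simp [hb, hbA]) (mem_univ c) (by simp at hc; simp [hc])
  rw [Finset.mem_sdiff] at hx
  have hyA : y ∉ A := fun h => hx.2 (hclosed y h x hxy.symm hx.1)
  have hyS : y ∉ S := fun h => hy (Finset.mem_sdiff.2 ⟨h, hyA⟩)
  have := hle (mk_mem_edgeCut.2 ⟨hxy, Or.inl ⟨by simpa using hx.1, by simpa using hyS⟩⟩)
  rw [mk_mem_edgeCut] at this
  simp [hx.2, hyA] at this

/-- A largest bond is the edge cut of a partition into two connected sides, and it is largest
among all such partitions. -/
theorem IsLargestBond.exists_sides (hG : G.ConnOn univ) {B : Set (Sym2 V)}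
    (hB : G.IsLargestBond B) : ∃ S : Finset V, B = G.edgeCut (S : Set V) ∧ G.ConnOn S ∧
      G.ConnOn Sᶜ ∧ ∀ X : Finset V, G.ConnOn X → G.ConnOn Xᶜ → G.pairs X Xᶜ ≤ G.pairs S Sᶜ := by
  obtain ⟨-, S, h1, h2, hBS⟩ := hB.1.1
  obtain ⟨S, rfl⟩ : ∃ S' : Finset V, S = (S' : Set V) := ⟨S.toFinset, by simp⟩
  have h1' : S.Nonempty := by exact_mod_cast h1
  have h2' : Sᶜ.Nonempty := by exact_mod_cast h2
  subst hBS
  refine ⟨S, rfl, hB.1.connOn_side hG h1' h2', ?_, ?_⟩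
  · apply IsBond.connOn_side hG _ h2' (by simpa using h1')
    rw [Finset.coe_compl, edgeCut_compl]
    exact hB.1
  · intro X hX hXc
    rw [← ncard_edgeCut, ← ncard_edgeCut]
    exact hB.2 _ (isBond_edgeCut hG hX hXc)

theorem IsKConnected.connOn_compl {k : ℕ} (hG : G.IsKConnected k) {R : Finset V} (hR : #R < k) :
    G.ConnOn Rᶜ :=
  connOn_of_induce (s := {v | v ∉ R}) (by simp) (hG.2 R hR)

/-- Deleting fewer than `k` neighbours would isolate `v` from a vertex that `k + 1 ≤ |V|` leaves
over. -/
theorem IsKConnected.le_nbrs {k : ℕ} (hG : G.IsKConnected k) (v : V) : k ≤ G.nbrs v univ := by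
  by_contra hlt
  rw [not_le, nbrs_eq_card] at hlt
  have hc := hG.connOn_compl hlt
  have hv : v ∈ ({y | G.Adj v y} : Finset V)ᶜ := by simp
  have hcard : #(insert v ({y | G.Adj v y} : Finset V)) < Fintype.card V :=
    (Finset.card_insert_le _ _).trans_lt (by have := hG.1; omega)
  obtain ⟨b, hb⟩ : ∃ b, b ∉ insert v ({y | G.Adj v y} : Finset V) := by
    by_contra! h
    rw [Finset.eq_univ_iff_forall.2 h, Finset.card_univ] at hcard
    exact lt_irrefl _ hcard
  obtain ⟨x, hx, y, hy, hxv, hyv, hxy⟩ := hc.exists_adj (A := {v}) hv (by simp) (b := b)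
    (by simp at hb ⊢; exact hb.2) (by simp at hb ⊢; exact hb.1)
  rw [Finset.mem_singleton] at hxv
  subst hxv
  simp at hy
  exact hy hxy

/-- Moving a set `P` across a largest bond does not gain edges. -/
theorem pairs_move_le {S T P : Finset V} (hST : T = Sᶜ)
    (hmax : ∀ X : Finset V, G.ConnOn X → G.ConnOn Xᶜ → G.pairs X Xᶜ ≤ G.pairs S T)
    (hP : P ⊆ S) (h1 : G.ConnOn (P ∪ T)) (h2 : G.ConnOn (S \ P)) :
    G.pairs P (S \ P) ≤ G.pairs P T := by
  subst hST
  have hc : (S \ P)ᶜ = P ∪ Sᶜ := by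
    ext v; simp; tauto
  have h := hmax (S \ P) h2 (by rwa [hc])
  have hd : Disjoint P Sᶜ := by
    rw [Finset.disjoint_left]; intro v hv hv'; exact (Finset.mem_compl.1 hv') (hP hv)
  rw [hc, pairs_union_right hd, pairs_comm _ P] at h
  have h3 : G.pairs S Sᶜ = G.pairs (S \ P) Sᶜ + G.pairs P Sᶜ := by
    rw [← pairs_union_left Finset.sdiff_disjoint, Finset.sdiff_union_of_subset hP]
  omega

end Fintype

end Basics

end SimpleGraph

/-! ### Cyclic enumerations, arcs and detours. -/

namespace SimpleGraph

section CycleMap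

open scoped Classical
open Finset

theorem natCast_ne_zero_of_lt {c k : ℕ} (h0 : 0 < k) (hk : k < c) : (k : ZMod c) ≠ 0 := by
  rw [Ne, ZMod.natCast_eq_zero_iff]
  exact fun h => absurd (Nat.le_of_dvd h0 h) (by omega)

variable {V : Type*} {G : SimpleGraph V} {c : ℕ} {f : ZMod c → V}

theorem zmod_induction [NeZero c] {p : ZMod c → Prop} {i : ZMod c} (hi : p i)
    (h : ∀ j, p j → p (j + 1)) (j : ZMod c) : p j := by
  have key : ∀ k : ℕ, p (i + k) := by
    intro k
    induction k with
    | zero => simpa using hi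
    | succ k ih =>
      have := h _ ih
      rwa [add_assoc, ← Nat.cast_succ] at this
  have := key (j - i).val
  rwa [ZMod.natCast_zmod_val, add_sub_cancel] at this

/-- A cycle gives a cyclic enumeration of its vertices. -/
theorem Walk.IsCycle.exists_cycleMap [NeZero c] {u : V} {C : G.Walk u u} (hC : C.IsCycle)
    (hc : C.length = c) : ∃ f : ZMod c → V, Function.Injective f ∧
      ∀ i, s(f i, f (i + 1)) ∈ C.edges := by
  have h3 := hC.three_le_length
  refine ⟨fun i => C.getVert i.val, ?_, ?_⟩
  · intro i j hij
    have hi := ZMod.val_lt i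
    have hj := ZMod.val_lt j
    exact ZMod.val_injective c (hC.getVert_injOn' (by simp only [Set.mem_ofPred_eq]; omega)
      (by simp only [Set.mem_ofPred_eq]; omega) hij)
  · intro i
    have hi := ZMod.val_lt i
    have : C.getVert (i + 1).val = C.getVert (i.val + 1) := by
      have h1 : (1 : ZMod c).val = 1 := ZMod.val_one'' (by omega)
      rcases Nat.lt_or_ge (i.val + 1) c with h | h
      · rw [ZMod.val_add_of_lt (by omega), h1]
      -- Wrap-around: position `c` of the closed walk is its base point, which is position `0`.
      · have hic : i.val + 1 = c := by omega
        have h0 : i + 1 = 0 := by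
          have := congrArg (Nat.cast : ℕ → ZMod c) hic
          simpa using this
        rw [h0, hic, ← hc]
        simp
    beta_reduce
    rw [this]
    exact (Walk.mk_mem_edges_iff_exists C).2 ⟨i.val, by omega, rfl⟩

/-- The arc of a cyclic enumeration with `k` edges that starts at `i`. -/
theorem exists_arc (hinj : Function.Injective f) (hadj : ∀ i, G.Adj (f i) (f (i + 1))) (k : ℕ) :
    ∀ i e : ZMod c, e = i + k → ∃ p : G.Walk (f i) (f e), p.length = k ∧
      (∀ z, z ∈ p.support ↔ ∃ j ≤ k, z = f (i + (j : ℕ))) ∧ (k < c → p.IsPath) := by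
  induction k with
  | zero =>
    intro i e he
    obtain rfl : e = i := by simpa using he
    exact ⟨Walk.nil, rfl, by simp, by simp⟩
  | succ k ih =>
    intro i e he
    obtain ⟨p, hl, hs, hp⟩ := ih (i + 1) e (by rw [he]; push_cast; ring)
    refine ⟨Walk.cons (hadj i) p, by simp [hl], ?_, ?_⟩
    · intro z
      rw [Walk.support_cons, List.mem_cons, hs]
      constructor
      · rintro (rfl | ⟨j, hj, rfl⟩)
        · exact ⟨0, by omega, by simp⟩
        · exact ⟨j + 1, by omega, by push_cast; ring_nf⟩
      · rintro ⟨j, hj, rfl⟩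
        rcases j with _ | j
        · left; simp
        · right; exact ⟨j, by omega, by push_cast; ring_nf⟩
    · intro hk
      rw [Walk.cons_isPath_iff]
      refine ⟨hp (by omega), ?_⟩
      rw [hs]
      rintro ⟨j, hj, h⟩
      have h1 := hinj h
      have h2 : ((j + 1 : ℕ) : ZMod c) = 0 := by
        push_cast
        linear_combination -h1
      exact natCast_ne_zero_of_lt (by omega) (by omega) h2

/-- Two disjoint paths whose ends are joined crosswise form a cycle. -/
theorem exists_cycle_of_paths {a b v w : V} (q : G.Walk a b) (p : G.Walk w v) (hq : q.IsPath)
    (hp : p.IsPath) (hd : ∀ z ∈ q.support, z ∉ p.support) (hva : G.Adj v a) (hbw : G.Adj b w)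
    (hl : 0 < p.length) :
    ∃ D : G.Walk v v, D.IsCycle ∧ D.length = p.length + q.length + 2 := by
  -- If `q` is a single vertex, the joining edges `va` and `bw` are distinct only because `v ≠ w`.
  have hvw : v ≠ w := by
    rintro rfl
    have := Walk.length_eq_zero_iff.2 (Walk.isPath_iff_nil.1 hp)
    omega
  refine ⟨Walk.cons hva (q.append (Walk.cons hbw p)), ?_, by simp; omega⟩
  rw [Walk.cons_isCycle_iff]
  constructor
  · rw [Walk.isPath_def, Walk.support_append, Walk.support_cons, List.tail_cons,
      List.nodup_append]
    refine ⟨hq.support_nodup, hp.support_nodup, ?_⟩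
    rintro x hx y hy rfl
    exact hd x hx hy
  · rw [Walk.edges_append, List.mem_append, Walk.edges_cons, List.mem_cons]
    rintro (h | h | h)
    · exact hd v (q.fst_mem_support_of_mem_edges h) p.end_mem_support
    · rw [Sym2.eq_iff] at h
      rcases h with ⟨rfl, rfl⟩ | ⟨h, -⟩
      · exact hd _ q.end_mem_support p.end_mem_support
      · exact hvw h
    · exact hd a q.start_mem_support (p.snd_mem_support_of_mem_edges h)

/-- If no cycle is longer than the enumerated one, a path off the cycle that joins two cycle
vertices at distance `r` is short. -/
theorem detour_le (hinj : Function.Injective f) (hadj : ∀ i, G.Adj (f i) (f (i + 1)))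
    (hmax : ∀ (v : V) (D : G.Walk v v), D.IsCycle → D.length ≤ c) {r : ℕ} (hr0 : 0 < r) (hr : r < c)
    {i e : ZMod c} (he : e = i + r)
    {a b : V} (q : G.Walk a b) (hq : q.IsPath) (hqf : ∀ z ∈ q.support, ∀ j, z ≠ f j)
    (ha : G.Adj (f i) a) (hb : G.Adj (f e) b) : q.length + 2 ≤ r := by
  have hcr : ((c - r : ℕ) : ZMod c) = -(r : ZMod c) := by
    rw [Nat.cast_sub hr.le]; simp
  -- The complementary arc closes up through `q` to a cycle of length `(c - r) + q.length + 2`.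
  obtain ⟨p, hl, hs, hp⟩ := exists_arc hinj hadj (c - r) e i (by rw [he, hcr]; ring)
  obtain ⟨D, hD, hDl⟩ := exists_cycle_of_paths q p hq (hp (by omega)) (by
    intro z hz hz'
    obtain ⟨j, -, h⟩ := (hs z).1 hz'
    exact hqf z hz _ h) ha hb.symm (by omega)
  have := hmax _ D hD
  omega

/-- Removing an initial arc from a cyclic enumeration leaves a connected set. -/
theorem connOn_arc_compl [NeZero c] (hinj : Function.Injective f) (hadj : ∀ i, G.Adj (f i) (f (i + 1)))
    {r : ℕ} (hr : r < c) (i : ZMod c) {X : Finset V}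
    (hX : ∀ z, z ∈ X ↔ (∃ j, z = f j) ∧ ∀ j < r, z ≠ f (i + (j : ℕ))) : G.ConnOn X := by
  obtain ⟨p, -, hs, -⟩ := exists_arc hinj hadj (c - 1 - r) (i + r) _ rfl
  refine connOn_of_walk p fun z => ?_
  rw [hs, hX]
  constructor
  · rintro ⟨j, hj, rfl⟩
    refine ⟨⟨_, rfl⟩, fun k hk h => ?_⟩
    have h1 := hinj h
    have h2 : ((r + j - k : ℕ) : ZMod c) = 0 := by
      rw [Nat.cast_sub (by omega)]
      push_cast
      linear_combination h1
    exact natCast_ne_zero_of_lt (by omega) (by omega) h2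
  · rintro ⟨⟨j, rfl⟩, h⟩
    have hlt := ZMod.val_lt (j - i)
    have hval : ((j - i).val : ZMod c) = j - i := ZMod.natCast_zmod_val _
    have hge : r ≤ (j - i).val := by
      by_contra hlt'
      refine h _ (not_le.1 hlt') ?_
      rw [hval]; congr 1; ring
    refine ⟨(j - i).val - r, by omega, ?_⟩
    rw [Nat.cast_sub hge, hval]; congr 1; ring

end CycleMap

end SimpleGraph

/-! ### Attachments of a set off a longest cycle, and moves across a largest bond. -/

namespace SimpleGraph

section LongestCycleLargestBond

open scoped Classical
open Finset

variable {V : Type*} {G : SimpleGraph V}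

/-- No side of a largest bond of a 3-connected graph is a single vertex. -/
theorem two_le_card_side [Fintype V] (hG : G.IsKConnected 3) {T : Finset V} (hT : G.ConnOn T)
    (hbond : ∀ X : Finset V, G.ConnOn X → G.ConnOn Xᶜ → G.pairs X Xᶜ ≤ G.pairs Tᶜ T) :
    2 ≤ #T := by
  by_contra hlt
  have h1 : #T = 1 := by have := hT.1.card_pos; omega
  obtain ⟨t, rfl⟩ := Finset.card_eq_one.1 h1
  obtain ⟨v, -, htv⟩ := nbrs_pos.1 (lt_of_lt_of_le (by norm_num) (hG.le_nbrs t))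
  have hvt : v ≠ t := htv.ne'
  have hset : ({t}ᶜ : Finset V) \ {v} = {t, v}ᶜ := by
    ext z; simp
  have h := pairs_move_le (P := {v}) (by simp) hbond (by simpa using hvt.symm)
    (by rw [← Finset.insert_eq]; exact (connOn_singleton t).insert_adj (by simp) htv)
    (by rw [hset]; exact hG.connOn_compl ((Finset.card_le_two).trans_lt (by norm_num)))
  have h2 := nbrs_sdiff (G := G) (v := v) (X := univ) (Y := {t, v}) (by simp)
  have h3 := hG.le_nbrs v
  have h4 : G.nbrs v {t, v} ≤ 1 := by
    rw [nbrs, Finset.sum_pair hvt.symm]; simp; split_ifs <;> simp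
  have h5 : G.nbrs v {t} ≤ 1 := by simpa using nbrs_le_card (G := G) v {t}
  rw [hset, pairs_singleton, pairs_singleton, Finset.compl_eq_univ_sdiff] at h
  omega

variable {c : ℕ} {f : ZMod c → V}

/-- Fewer than three vertices lie in `Z` and `f '' R`, so deleting them leaves a connected graph in
which `K` still reaches the cycle; the edge leaving `K` can only end on a surviving cycle vertex. -/
theorem exists_attachment [Fintype V] [NeZero c] (hG : G.IsKConnected 3) (hinj : Function.Injective f)
    (hc : 3 ≤ c) {K Z : Finset V} (hK : K.Nonempty) (hKf : ∀ j, f j ∉ K) (hZf : ∀ j, f j ∉ Z)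
    (hKZ : Disjoint K Z) (hnb : ∀ k ∈ K, ∀ z ∉ K, G.Adj k z → z ∈ Z ∨ ∃ j, z = f j)
    {R : Finset (ZMod c)} (hR : #Z + #R < 3) : ∃ i ∉ R, ∃ k ∈ K, G.Adj (f i) k := by
  have hc1 := hG.connOn_compl (R := Z ∪ R.image f)
    ((Finset.card_union_le _ _).trans_lt (by have := Finset.card_image_le (s := R) (f := f); omega))
  obtain ⟨k, hk⟩ := hK
  obtain ⟨j, hj⟩ : ∃ j, j ∉ R := by
    by_contra! h
    have := Finset.card_univ (α := ZMod c)
    rw [← Finset.eq_univ_iff_forall.2 h, ZMod.card] at this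
    omega
  have hmemK : ∀ z ∈ K, z ∈ (Z ∪ R.image f)ᶜ := by
    intro z hz
    simp only [Finset.mem_compl, Finset.mem_union, Finset.mem_image, not_or, not_exists, not_and]
    exact ⟨Finset.disjoint_left.1 hKZ hz, fun i _ h => hKf i (h ▸ hz)⟩
  obtain ⟨x, hx, y, hy, hxK, hyK, hxy⟩ := hc1.exists_adj (hmemK k hk) hk (b := f j) (by
    simp only [Finset.mem_compl, Finset.mem_union, Finset.mem_image, not_or, not_exists, not_and]
    exact ⟨hZf j, fun i hi h => hj (hinj h ▸ hi)⟩) (hKf j)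
  simp only [Finset.mem_compl, Finset.mem_union, Finset.mem_image, not_or, not_exists,
    not_and] at hy
  rcases hnb x hxK y hyK hxy with h | ⟨i, rfl⟩
  · exact absurd h hy.1
  · exact ⟨i, fun hi => hy.2 i hi rfl, x, hxK, hxy.symm⟩

/-- Otherwise the edge from `f i` to `f (i + 1)` could be replaced by a longer path through `K`. -/
theorem not_adj_succ (hinj : Function.Injective f) (hadj : ∀ i, G.Adj (f i) (f (i + 1)))
    (hmax : ∀ (v : V) (D : G.Walk v v), D.IsCycle → D.length ≤ c) (hc : 3 ≤ c) {K : Finset V}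
    (hK : G.ConnOn K) (hKf : ∀ j, f j ∉ K) {i : ZMod c} {a b : V} (ha : a ∈ K) (hb : b ∈ K)
    (hia : G.Adj (f i) a) : ¬ G.Adj (f (i + 1)) b := by
  intro hib
  obtain ⟨q, hq, hqK⟩ := hK.exists_path ha hb
  have := detour_le hinj hadj hmax (r := 1) (by norm_num) (by omega) (by simp) q hq
    (fun z hz j h => hKf j (h ▸ hqK z hz)) hia hib
  omega

/-- A detour replacing two cycle edges can afford only one inner vertex. -/
theorem eq_of_adj_succ_succ (hinj : Function.Injective f) (hadj : ∀ i, G.Adj (f i) (f (i + 1)))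
    (hmax : ∀ (v : V) (D : G.Walk v v), D.IsCycle → D.length ≤ c) (hc : 3 ≤ c) {K : Finset V}
    (hK : G.ConnOn K) (hKf : ∀ j, f j ∉ K) {i : ZMod c} {a b : V} (ha : a ∈ K) (hb : b ∈ K)
    (hia : G.Adj (f i) a) (hib : G.Adj (f (i + 2)) b) : a = b := by
  obtain ⟨q, hq, hqK⟩ := hK.exists_path ha hb
  have := detour_le hinj hadj hmax (r := 2) (by norm_num) (by omega) (by simp) q hq
    (fun z hz j h => hKf j (h ▸ hqK z hz)) hia hib
  exact Walk.eq_of_length_eq_zero (p := q) (by omega)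

theorem two_le_nbrs_cycle (hinj : Function.Injective f) (hadj : ∀ i, G.Adj (f i) (f (i + 1)))
    (hc : 3 ≤ c) {X : Finset V} (hX : ∀ j, f j ∈ X) (i : ZMod c) : 2 ≤ G.nbrs (f i) X := by
  refine two_le_nbrs (hX (i - 1)) (hX (i + 1)) (fun h => ?_) ?_ (hadj i)
  · refine natCast_ne_zero_of_lt (c := c) (k := 2) (by norm_num) (by omega) ?_
    push_cast
    linear_combination -(hinj h)
  · have := (hadj (i - 1)).symm
    rwa [sub_add_cancel] at this

/-- A side of a largest bond that avoids a longest cycle sends many edges to a cycle vertex,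
provided that this vertex and its successor do not disconnect the other side. -/
theorem nbrs_lt_nbrs_of_connOn [Fintype V] (hG : G.IsKConnected 3) (hinj : Function.Injective f)
    (hadj : ∀ i, G.Adj (f i) (f (i + 1)))
    (hmax : ∀ (v : V) (D : G.Walk v v), D.IsCycle → D.length ≤ c) (hc : 3 ≤ c)
    {T : Finset V} (hT : G.ConnOn T)
    (hbond : ∀ X : Finset V, G.ConnOn X → G.ConnOn Xᶜ → G.pairs X Xᶜ ≤ G.pairs Tᶜ T)
    (hTf : ∀ j, f j ∉ T) {i : ZMod c} {t : V} (ht : t ∈ T) (hit : G.Adj (f i) t)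
    (hconn : G.ConnOn (Tᶜ \ {f i, f (i + 1)})) : G.nbrs (f i) Tᶜ < G.nbrs (f i) T := by
  have hne : f i ≠ f (i + 1) := (hadj i).ne
  have hsub : ({f i, f (i + 1)} : Finset V) ⊆ Tᶜ := by
    intro z hz
    simp only [Finset.mem_insert, Finset.mem_singleton] at hz
    rcases hz with rfl | rfl <;> simp [hTf]
  have h := pairs_move_le (P := {f i, f (i + 1)}) (by simp) hbond hsub (by
    have := (hT.insert_adj ht hit.symm).insert_adj (Finset.mem_insert_self _ _) (hadj i)
    convert this using 1
    ext z; simp; tauto) hconn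
  have hw : G.nbrs (f (i + 1)) T = 0 := nbrs_eq_zero.2 fun b hb =>
    not_adj_succ hinj hadj hmax hc hT hTf ht hb hit
  have h1 := nbrs_sdiff (G := G) (v := f i) hsub
  have h2 := nbrs_sdiff (G := G) (v := f (i + 1)) hsub
  have h3 := nbrs_sdiff (G := G) (v := f (i + 1)) (X := univ) (Y := T) (by simp)
  have h4 := hG.le_nbrs (f (i + 1))
  have h5 : G.nbrs (f i) {f i, f (i + 1)} ≤ 1 := by
    rw [nbrs, Finset.sum_pair hne]; simp; split_ifs <;> simp
  have h6 : G.nbrs (f (i + 1)) {f i, f (i + 1)} ≤ 1 := by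
    rw [nbrs, Finset.sum_pair hne]; simp; split_ifs <;> simp
  rw [← Finset.compl_eq_univ_sdiff] at h3
  -- The successor sends at least `3 - 1` edges to the rest of `Tᶜ` and none to `T`; `f i` loses at
  -- most one neighbour in `Tᶜ` to the pair.
  rw [pairs, pairs, Finset.sum_pair hne, Finset.sum_pair hne] at h
  omega

/-- A nonempty set off a cycle that contains all of its neighbours off the cycle is attached to at
least three cycle vertices. -/
theorem three_le_card_attachments [Fintype V] [NeZero c] (hG : G.IsKConnected 3) (hinj : Function.Injective f)
    (hc : 3 ≤ c) {K : Finset V} (hK : K.Nonempty) (hKf : ∀ j, f j ∉ K)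
    (hnb : ∀ k ∈ K, ∀ z ∉ K, G.Adj k z → ∃ j, z = f j) :
    3 ≤ #{i : ZMod c | ∃ k ∈ K, G.Adj (f i) k} := by
  by_contra hlt
  obtain ⟨i, hi, hi'⟩ := exists_attachment hG hinj hc hK hKf (Z := ∅) (by simp) (by simp)
    (fun k hk z hz h => Or.inr (hnb k hk z hz h))
    (R := {i : ZMod c | ∃ k ∈ K, G.Adj (f i) k}) (by simpa using hlt)
  simp only [Finset.mem_filter, Finset.mem_univ, true_and] at hi
  exact hi hi'

theorem card_image_add (Y : Finset (ZMod c)) (a : ZMod c) : #(Y.image (· + a)) = #Y :=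
  Finset.card_image_of_injective _ (add_left_injective a)

theorem card_range_le [NeZero c] (hinj : Function.Injective f) {X : Finset V} (hX : ∀ j, f j ∈ X) :
    c ≤ #X := by
  have h1 : #((univ : Finset (ZMod c)).image f) = c := by
    rw [Finset.card_image_of_injective _ hinj, Finset.card_univ, ZMod.card]
  rw [← h1]
  apply Finset.card_le_card
  intro z hz
  obtain ⟨j, -, rfl⟩ := Finset.mem_image.1 hz
  exact hX j

end LongestCycleLargestBond

end SimpleGraph

/-! ### The case of a cycle missing at most three vertices. -/

namespace SimpleGraph

section LongestCycleLargestBond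

open scoped Classical
open Finset

variable {V : Type*} {G : SimpleGraph V} {c : ℕ} [NeZero c] {f : ZMod c → V}

theorem connOn_cycle_sdiff_pair (hinj : Function.Injective f)
    (hadj : ∀ i, G.Adj (f i) (f (i + 1))) (hc : 3 ≤ c) {X : Finset V}
    (hX : ∀ z, z ∈ X ↔ ∃ j, z = f j) (i : ZMod c) : G.ConnOn (X \ {f i, f (i + 1)}) := by
  refine connOn_arc_compl hinj hadj (r := 2) (by omega) i fun z => ?_
  rw [Finset.mem_sdiff, hX]
  refine and_congr_right fun _ => ?_
  simp only [Finset.mem_insert, Finset.mem_singleton, not_or]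
  constructor
  · rintro ⟨h0, h1⟩ j hj
    interval_cases j
    · simpa using h0
    · simpa using h1
  · intro h
    exact ⟨by simpa using h 0 (by norm_num), by simpa using h 1 (by norm_num)⟩

theorem connOn_cycle_sdiff_triple (hinj : Function.Injective f)
    (hadj : ∀ i, G.Adj (f i) (f (i + 1))) (hc : 4 ≤ c) {X : Finset V}
    (hX : ∀ z, z ∈ X ↔ ∃ j, z = f j) (i : ZMod c) :
    G.ConnOn (X \ {f i, f (i + 1), f (i + 2)}) := by
  refine connOn_arc_compl hinj hadj (r := 3) (by omega) i fun z => ?_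
  rw [Finset.mem_sdiff, hX]
  refine and_congr_right fun _ => ?_
  simp only [Finset.mem_insert, Finset.mem_singleton, not_or]
  constructor
  · rintro ⟨h0, h1, h2⟩ j hj
    interval_cases j
    · simpa using h0
    · simpa using h1
    · simpa using h2
  · intro h
    exact ⟨by simpa using h 0 (by norm_num), by simpa using h 1 (by norm_num),
      by simpa using h 2 (by norm_num)⟩

/-- If one side of a largest bond is the vertex set of a longest cycle, the other side has at least
four vertices. -/
theorem four_le_card_of_compl_eq_cycle [Fintype V] (hG : G.IsKConnected 3)
    (hinj : Function.Injective f)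
    (hadj : ∀ i, G.Adj (f i) (f (i + 1)))
    (hmax : ∀ (v : V) (D : G.Walk v v), D.IsCycle → D.length ≤ c) (hc : 4 ≤ c)
    {T : Finset V} (hT : G.ConnOn T) (h2 : 2 ≤ #T)
    (hbond : ∀ X : Finset V, G.ConnOn X → G.ConnOn Xᶜ → G.pairs X Xᶜ ≤ G.pairs Tᶜ T)
    (hTf : ∀ z, z ∈ Tᶜ ↔ ∃ j, z = f j) {i : ZMod c} {t : V} (ht : t ∈ T)
    (hit : G.Adj (f i) t) : 4 ≤ #T := by
  by_contra hlt
  have hTf' : ∀ j, f j ∉ T := fun j => Finset.mem_compl.1 ((hTf _).2 ⟨j, rfl⟩)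
  have hS : ∀ j, f j ∈ Tᶜ := fun j => (hTf _).2 ⟨j, rfl⟩
  have hstep := nbrs_lt_nbrs_of_connOn hG hinj hadj hmax (by omega) hT hbond hTf' ht hit
    (connOn_cycle_sdiff_pair hinj hadj (by omega) hTf i)
  have hS2 := two_le_nbrs_cycle hinj hadj (by omega) hS i
  have hT3 := nbrs_le_card (G := G) (f i) T
  -- With `|T| ≤ 3`, the inequalities `2 ≤ d_S < d_T ≤ 3` force `d_S = 2` and `d_T = |T| = 3`, where
  -- `d_S`, `d_T` count the neighbours of `f i` in `Tᶜ` and `T`.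
  have hall : ∀ b ∈ T, G.Adj (f i) b := by
    have : #T ≤ #{y ∈ T | G.Adj (f i) y} := by rw [← nbrs_eq_card]; omega
    exact fun b hb => (Finset.mem_filter.1
      ((Finset.eq_of_subset_of_card_le (Finset.filter_subset _ _) this).symm ▸ hb)).2
  have e12 : i + 1 + 1 = i + 2 := by ring
  have hadj2 : G.Adj (f (i + 1)) (f (i + 2)) := e12 ▸ hadj (i + 1)
  have hwT : ∀ b ∈ T, ¬ G.Adj (f (i + 1)) b := fun b hb =>
    not_adj_succ hinj hadj hmax (by omega) hT hTf' ht hb hit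
  have hxT : ∀ b ∈ T, ¬ G.Adj (f (i + 2)) b := by
    intro b hb hib
    obtain ⟨a, ha, hab⟩ := Finset.exists_mem_ne (by omega : 1 < #T) b
    exact hab (eq_of_adj_succ_succ hinj hadj hmax (by omega) hT hTf' ha hb (hall a ha) hib)
  have hvx : ¬ G.Adj (f i) (f (i + 2)) := by
    intro h
    have hprev := (hadj (i - 1)).symm
    rw [sub_add_cancel] at hprev
    have := three_le_nbrs (G := G) (hS (i - 1)) (hS (i + 1)) (hS (i + 2)) (fun h => ?_)
      (fun h => ?_) hadj2.ne hprev (hadj i) h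
    · omega
    · refine natCast_ne_zero_of_lt (c := c) (k := 2) (by norm_num) (by omega) ?_
      push_cast
      linear_combination -(hinj h)
    · refine natCast_ne_zero_of_lt (c := c) (k := 3) (by norm_num) (by omega) ?_
      push_cast
      linear_combination -(hinj h)
  have nvw : f i ≠ f (i + 1) := (hadj i).ne
  have nwx : f (i + 1) ≠ f (i + 2) := hadj2.ne
  have nvx : f i ≠ f (i + 2) := by
    intro h
    refine natCast_ne_zero_of_lt (c := c) (k := 2) (by norm_num) (by omega) ?_
    push_cast
    linear_combination -(hinj h)
  have hsub : ({f i, f (i + 1), f (i + 2)} : Finset V) ⊆ Tᶜ := by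
    intro z hz
    simp only [Finset.mem_insert, Finset.mem_singleton] at hz
    rcases hz with rfl | rfl | rfl <;> exact hS _
  have hsum : ∀ g : V → ℕ, ∑ z ∈ ({f i, f (i + 1), f (i + 2)} : Finset V), g z =
      g (f i) + (g (f (i + 1)) + g (f (i + 2))) := by
    intro g
    rw [Finset.sum_insert (by simp [nvw, nvx]), Finset.sum_pair nwx]
  have h := pairs_move_le (P := {f i, f (i + 1), f (i + 2)}) (by simp) hbond hsub (by
    have := ((hT.insert_adj ht hit.symm).insert_adj (Finset.mem_insert_self _ _)
      (hadj i)).insert_adj (Finset.mem_insert_self _ _) hadj2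
    convert this using 1
    ext z; simp; tauto)
    (connOn_cycle_sdiff_triple hinj hadj hc hTf i)
  -- The three moved vertices send at least `1 + 1 + 2` edges to the rest of `Tᶜ`, but only the
  -- three edges at `f i` go to `T`.
  rw [pairs, pairs, hsum, hsum, nbrs_eq_zero.2 hwT, nbrs_eq_zero.2 hxT] at h
  have a1 := nbrs_sdiff (G := G) (v := f i) hsub
  have a2 := nbrs_sdiff (G := G) (v := f (i + 1)) hsub
  have a3 := nbrs_sdiff (G := G) (v := f (i + 2)) hsub
  have b1 : G.nbrs (f i) {f i, f (i + 1), f (i + 2)} ≤ 1 := by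
    rw [nbrs, hsum]; simp [hvx]; split_ifs <;> simp
  have b2 : G.nbrs (f (i + 1)) {f i, f (i + 1), f (i + 2)} ≤ 2 := by
    rw [nbrs, hsum]; simp; split_ifs <;> simp
  have b3 : G.nbrs (f (i + 2)) {f i, f (i + 1), f (i + 2)} ≤ 1 := by
    rw [nbrs, hsum]; simp [G.adj_comm _ (f i), hvx]; split_ifs <;> simp
  have c2 := nbrs_sdiff (G := G) (v := f (i + 1)) (X := univ) (Y := T) (by simp)
  have c3 := nbrs_sdiff (G := G) (v := f (i + 2)) (X := univ) (Y := T) (by simp)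
  rw [← Finset.compl_eq_univ_sdiff, nbrs_eq_zero.2 hwT] at c2
  rw [← Finset.compl_eq_univ_sdiff, nbrs_eq_zero.2 hxT] at c3
  have d2 := hG.le_nbrs (f (i + 1))
  have d3 := hG.le_nbrs (f (i + 2))
  omega

/-- A longest cycle that misses at most three vertices does not avoid a largest bond. -/
theorem card_lt_of_side_disjoint_cycle [Fintype V] (hG : G.IsKConnected 3)
    (hinj : Function.Injective f)
    (hadj : ∀ i, G.Adj (f i) (f (i + 1)))
    (hmax : ∀ (v : V) (D : G.Walk v v), D.IsCycle → D.length ≤ c) (hc : 3 ≤ c)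
    {T : Finset V} (hT : G.ConnOn T)
    (hbond : ∀ X : Finset V, G.ConnOn X → G.ConnOn Xᶜ → G.pairs X Xᶜ ≤ G.pairs Tᶜ T)
    (hTf : ∀ j, f j ∉ T) : c + 3 < Fintype.card V := by
  by_contra! hcard
  have hT2 := two_le_card_side hG hT hbond
  have hS : ∀ j, f j ∈ Tᶜ := fun j => Finset.mem_compl.2 (hTf j)
  have hQ : #((univ : Finset (ZMod c)).image f) = c := by
    rw [Finset.card_image_of_injective _ hinj, Finset.card_univ, ZMod.card]
  have hQS : (univ : Finset (ZMod c)).image f ⊆ Tᶜ := by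
    intro z hz
    obtain ⟨j, -, rfl⟩ := Finset.mem_image.1 hz
    exact hS j
  have hmemQ : ∀ z, z ∈ (univ : Finset (ZMod c)).image f ↔ ∃ j, z = f j := by
    intro z; simp [eq_comm]
  have hcS := Finset.card_compl T
  have hTV := Finset.card_le_univ T
  have hsd := Finset.card_sdiff_add_card_eq_card hQS
  -- it suffices to find a cycle vertex attached to `T` that satisfies the connectivity condition
  have key : ∀ i t, t ∈ T → G.Adj (f i) t →
      G.ConnOn (Tᶜ \ {f i, f (i + 1)}) → 3 ≤ #T := by
    intro i t ht hit hconn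
    have h1 := nbrs_lt_nbrs_of_connOn hG hinj hadj hmax hc hT hbond hTf ht hit hconn
    have h2 := two_le_nbrs_cycle hinj hadj hc hS i
    have h3 := nbrs_le_card (G := G) (f i) T
    omega
  have arc := connOn_cycle_sdiff_pair hinj hadj hc hmemQ
  -- At most three vertices are off the cycle and at least two of them are in `T`, so at most one is
  -- in `Tᶜ`.
  rcases Nat.eq_zero_or_pos #(Tᶜ \ (univ : Finset (ZMod c)).image f) with h0 | hpos
  · have hSQ : Tᶜ = (univ : Finset (ZMod c)).image f :=
      Finset.Subset.antisymm (Finset.sdiff_eq_empty_iff_subset.1 (Finset.card_eq_zero.1 h0)) hQS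
    have hmem : ∀ z, z ∈ Tᶜ ↔ ∃ j, z = f j := by rw [hSQ]; exact hmemQ
    have hnb : ∀ k ∈ T, ∀ z ∉ T, G.Adj k z → z ∈ (∅ : Finset V) ∨ ∃ j, z = f j :=
      fun k _ z hz _ => Or.inr ((hmem z).1 (Finset.mem_compl.2 hz))
    obtain ⟨i, -, t, ht, hit⟩ := exists_attachment hG hinj hc hT.1 hTf (Z := ∅) (by simp)
      (by simp) hnb (R := ∅) (by simp)
    have h3 := key i t ht hit (by rw [hSQ]; exact arc i)
    -- Avoiding `i` and `i + 2` on a triangle would leave only `i + 1`, the forbidden successor.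
    obtain ⟨j, hj, t', ht', hjt⟩ := exists_attachment hG hinj hc hT.1 hTf (Z := ∅) (by simp)
      (by simp) hnb (R := {i, i + 2}) (by
        rw [Finset.card_empty, zero_add]; exact (Finset.card_le_two).trans_lt (by norm_num))
    have hc4 : 4 ≤ c := by
      by_contra hlt
      have hc3 : c = 3 := by omega
      subst hc3
      have hji : j = i + 1 := by
        clear * - hj; revert i j; decide
      rw [hji] at hjt
      exact not_adj_succ hinj hadj hmax hc hT hTf ht ht' hit hjt
    have := four_le_card_of_compl_eq_cycle hG hinj hadj hmax hc4 hT hT2 hbond hmem ht hit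
    omega
  · have h1 : #(Tᶜ \ (univ : Finset (ZMod c)).image f) = 1 := by omega
    have hT2' : #T = 2 := by omega
    obtain ⟨z, hz⟩ := Finset.card_eq_one.1 h1
    have hzS : z ∈ Tᶜ \ (univ : Finset (ZMod c)).image f := by rw [hz]; simp
    rw [Finset.mem_sdiff, Finset.mem_compl, hmemQ] at hzS
    have hcases : ∀ y, y ∉ T → y = z ∨ ∃ j, y = f j := by
      intro y hy
      by_cases hyQ : y ∈ (univ : Finset (ZMod c)).image f
      · exact Or.inr ((hmemQ y).1 hyQ)
      · left
        have : y ∈ Tᶜ \ (univ : Finset (ZMod c)).image f :=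
          Finset.mem_sdiff.2 ⟨Finset.mem_compl.2 hy, hyQ⟩
        rw [hz] at this
        simpa using this
    have hzf : ∀ j, f j ≠ z := fun j h => hzS.2 ⟨j, h.symm⟩
    -- it suffices that `z` keeps a neighbour on the cycle
    have key2 : ∀ i t l, t ∈ T → G.Adj (f i) t → G.Adj z (f l) → l ≠ i → l ≠ i + 1 → False := by
      intro i t l ht hit hzl hli hli1
      have : 3 ≤ #T := by
        refine key i t ht hit ?_
        have h := (arc i).insert_adj (x := f l) (z := z) (by
          rw [Finset.mem_sdiff, hmemQ]
          exact ⟨⟨l, rfl⟩, by simp [hinj.eq_iff, hli, hli1]⟩) hzl.symm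
        convert h using 1
        ext y
        rw [Finset.mem_insert (b := z), Finset.mem_sdiff, Finset.mem_sdiff, Finset.mem_compl, hmemQ]
        simp only [Finset.mem_insert, Finset.mem_singleton, not_or]
        constructor
        · rintro ⟨hy, h01⟩
          rcases hcases y hy with rfl | h
          · exact Or.inl rfl
          · exact Or.inr ⟨h, h01⟩
        · rintro (rfl | ⟨⟨j, rfl⟩, h01⟩)
          · exact ⟨hzS.1, (hzf _).symm, (hzf _).symm⟩
          · exact ⟨hTf j, h01⟩
      omega
    obtain ⟨l, hzl⟩ : ∃ l, G.Adj z (f l) := by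
      by_contra! hno
      have h3 := hG.le_nbrs z
      have h4 : G.nbrs z univ = G.nbrs z T := by
        have := nbrs_sdiff (G := G) (v := z) (X := univ) (Y := T) (by simp)
        rw [← this, ← Finset.compl_eq_univ_sdiff, add_eq_right, nbrs_eq_zero]
        intro y hy hzy
        rcases hcases y (Finset.mem_compl.1 hy) with rfl | ⟨j, rfl⟩
        · exact G.irrefl hzy
        · exact hno j hzy
      have h5 := nbrs_le_card (G := G) z T
      omega
    by_cases hmany : ∃ l' ≠ l, G.Adj z (f l')
    · obtain ⟨l', hne, hzl'⟩ := hmany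
      obtain ⟨i, -, t, ht, hit⟩ := exists_attachment hG hinj hc hT.1 hTf (Z := {z})
        (by simpa using hzf) (by simpa using hzS.1)
        (fun k _ y hy _ => (hcases y hy).imp_left (by simp)) (R := ∅) (by simp)
      -- Hence two cycle neighbours of `z` cannot both be deleted.
      have hnot : ¬ (G.Adj (f i) z ∧ G.Adj (f (i + 1)) z) := fun h =>
        not_adj_succ hinj hadj hmax hc (connOn_singleton z) (by simpa using hzf)
          (Finset.mem_singleton_self z) (Finset.mem_singleton_self z) h.1 h.2
      by_cases hl : l = i ∨ l = i + 1
      · by_cases hl' : l' = i ∨ l' = i + 1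
        · refine hnot ⟨?_, ?_⟩
          · rcases hl with rfl | rfl
            · exact hzl.symm
            · rcases hl' with rfl | rfl
              · exact hzl'.symm
              · exact absurd rfl hne
          · rcases hl with rfl | rfl
            · rcases hl' with rfl | rfl
              · exact absurd rfl hne
              · exact hzl'.symm
            · exact hzl.symm
        · rw [not_or] at hl'
          exact key2 i t l' ht hit hzl' hl'.1 hl'.2
      · rw [not_or] at hl
        exact key2 i t l ht hit hzl hl.1 hl.2
    -- Here `f l` is the only cycle neighbour of `z`. Excluding `l` and `l - 1` keeps it out of the
    -- moved pair, and excluding `l` makes the attachment go to `T`, not `z`.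
    · obtain ⟨i, hi, t, ht, hit⟩ := exists_attachment hG hinj hc (K := insert z T) (by simp)
        (by simp [hTf, hzf]) (Z := ∅) (by simp) (by simp)
        (fun k _ y hy _ => Or.inr ((hcases y (fun h => hy (by simp [h]))).resolve_left
          (fun h => hy (by simp [h])))) (R := {l, l - 1}) (by
            rw [Finset.card_empty, zero_add]
            exact (Finset.card_le_two).trans_lt (by norm_num))
      simp only [Finset.mem_insert, Finset.mem_singleton, not_or] at hi
      rcases Finset.mem_insert.1 ht with rfl | ht
      · exact hmany ⟨i, hi.1, hit.symm⟩
      · exact key2 i t l ht hit hzl (Ne.symm hi.1) (fun h => hi.2 (by rw [h]; ring))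

end LongestCycleLargestBond

end SimpleGraph

/-! ### The case of a bond whose sides span few edges. -/

namespace SimpleGraph

section LongestCycleLargestBond

open scoped Classical
open Finset

variable {V : Type*} {G : SimpleGraph V} {c : ℕ} [NeZero c] {f : ZMod c → V}

/-- A connected set that avoids `Q` lies in a connected set that avoids `Q` and is closed under
taking neighbours outside `Q`. -/
theorem ConnOn.exists_maximal_avoiding [Fintype V] {T : Finset V} (hT : G.ConnOn T) {Q : Set V}
    (hTQ : ∀ v ∈ T, v ∉ Q) : ∃ K : Finset V, T ⊆ K ∧ G.ConnOn K ∧ (∀ v ∈ K, v ∉ Q) ∧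
      ∀ k ∈ K, ∀ z ∉ K, G.Adj k z → z ∈ Q := by
  obtain ⟨K, hK, hKmax⟩ := Finset.exists_max_image
    ({X | T ⊆ X ∧ G.ConnOn X ∧ ∀ v ∈ X, v ∉ Q} : Finset (Finset V)) Finset.card
    ⟨T, by simpa using ⟨hT, hTQ⟩⟩
  simp only [Finset.mem_filter, Finset.mem_univ, true_and] at hK hKmax
  refine ⟨K, hK.1, hK.2.1, hK.2.2, fun k hk z hz hkz => ?_⟩
  by_contra hzQ
  have := hKmax (insert z K) ⟨hK.1.trans (Finset.subset_insert _ _), hK.2.1.insert_adj hk hkz, by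
    intro v hv
    rcases Finset.mem_insert.1 hv with rfl | hv
    · exact hzQ
    · exact hK.2.2 v hv⟩
  rw [Finset.card_insert_of_notMem hz] at this
  omega

/-- If a bond avoids a longest cycle and both sides have few edges, few vertices are not attached
to the component off the cycle that contains a side of the bond. -/
theorem card_compl_le_card_attachments_add [Fintype V] (hG : G.IsKConnected 3)
    (hinj : Function.Injective f) (hadj : ∀ i, G.Adj (f i) (f (i + 1))) (hc : 3 ≤ c)
    {T K : Finset V} (hT : G.ConnOn T) (hS : G.ConnOn Tᶜ) (hTK : T ⊆ K) (hKf : ∀ j, f j ∉ K)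
    (hnb : ∀ k ∈ K, ∀ z ∉ K, G.Adj k z → ∃ j, z = f j)
    (hfew : G.pairs Tᶜ Tᶜ + G.pairs T T ≤ 2 * Fintype.card V + 2) :
    #Kᶜ ≤ #{i : ZMod c | ∃ k ∈ K, G.Adj (f i) k} + 4 := by
  set Y : Finset (ZMod c) := {i | ∃ k ∈ K, G.Adj (f i) k} with hY
  have hKf' : ∀ j, f j ∈ Kᶜ := fun j => Finset.mem_compl.2 (hKf j)
  obtain ⟨t, ht⟩ := hT.1
  -- In edges: `T` spans at least `|T| - 1`, and `Tᶜ` spans at least `|Tᶜ| - |Kᶜ|` more than `Kᶜ`.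
  have h1 := hT.pairs_ge (Finset.singleton_nonempty t) (by simpa using ht)
  have h2 := hS.pairs_ge (R := Kᶜ) ⟨_, hKf' 0⟩ (by simpa using hTK)
  have h3 := Finset.card_add_card_compl T
  rw [Finset.card_singleton] at h1
  have h4 : ∀ v ∈ Kᶜ, 3 ≤ G.nbrs v Kᶜ + if v ∈ Y.image f then 1 else 0 := by
    intro v hv
    split_ifs with hvY
    · obtain ⟨i, -, rfl⟩ := Finset.mem_image.1 hvY
      have := two_le_nbrs_cycle hinj hadj hc hKf' i
      omega
    · have h5 := hG.le_nbrs v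
      have h6 := nbrs_sdiff (G := G) (v := v) (X := univ) (Y := K) (by simp)
      have h7 : G.nbrs v K = 0 := by
        refine nbrs_eq_zero.2 fun k hk hvk => ?_
        obtain ⟨j, rfl⟩ := hnb k hk v (Finset.mem_compl.1 hv) hvk.symm
        exact hvY (Finset.mem_image_of_mem f (by simpa [hY] using ⟨k, hk, hvk⟩))
      rw [← Finset.compl_eq_univ_sdiff] at h6
      omega
  have h8 := Finset.sum_le_sum h4
  rw [Finset.sum_add_distrib, Finset.sum_const, smul_eq_mul, ← Finset.card_filter] at h8
  have h9 : #{v ∈ Kᶜ | v ∈ Y.image f} ≤ #Y :=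
    (Finset.card_le_card (fun v hv => (Finset.mem_filter.1 hv).2)).trans Finset.card_image_le
  change _ ≤ G.pairs Kᶜ Kᶜ + _ at h8
  omega

/-- A longest cycle does not avoid a largest bond whose sides have few edges. -/
theorem two_mul_card_lt_pairs_add_pairs [Fintype V] (hG : G.IsKConnected 3)
    (hinj : Function.Injective f) (hadj : ∀ i, G.Adj (f i) (f (i + 1)))
    (hmax : ∀ (v : V) (D : G.Walk v v), D.IsCycle → D.length ≤ c) (hc : 3 ≤ c)
    {T : Finset V} (hT : G.ConnOn T) (hS : G.ConnOn Tᶜ)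
    (hbond : ∀ X : Finset V, G.ConnOn X → G.ConnOn Xᶜ → G.pairs X Xᶜ ≤ G.pairs Tᶜ T)
    (hTf : ∀ j, f j ∉ T) : 2 * Fintype.card V + 2 < G.pairs Tᶜ Tᶜ + G.pairs T T := by
  by_contra! hfew
  have hT2 := two_le_card_side hG hT hbond
  obtain ⟨K, hTK, hK, hKf, hnb⟩ := hT.exists_maximal_avoiding (Q := Set.range f)
    (by rintro v hv ⟨j, rfl⟩; exact hTf j hv)
  replace hKf : ∀ j, f j ∉ K := fun j h => hKf _ h ⟨j, rfl⟩
  replace hnb : ∀ k ∈ K, ∀ z ∉ K, G.Adj k z → ∃ j, z = f j := fun k hk z hz h => by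
    obtain ⟨j, hj⟩ := hnb k hk z hz h
    exact ⟨j, hj.symm⟩
  have hY3 := three_le_card_attachments hG hinj hc hK.1 hKf hnb
  have hcY := card_compl_le_card_attachments_add hG hinj hadj hc hT hS hTK hKf hnb hfew
  set Y : Finset (ZMod c) := {i | ∃ k ∈ K, G.Adj (f i) k} with hY
  have hcR := card_range_le hinj (X := Kᶜ) (by simpa using hKf)
  have memY : ∀ i, i ∈ Y ↔ ∃ k ∈ K, G.Adj (f i) k := by simp [hY]
  have hsucc : ∀ i ∈ Y, i + 1 ∉ Y := by
    intro i hi hi1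
    obtain ⟨a, ha, hia⟩ := (memY i).1 hi
    obtain ⟨b, hb, hib⟩ := (memY _).1 hi1
    exact not_adj_succ hinj hadj hmax hc hK hKf ha hb hia hib
  have hssucc : ∀ i a b, a ∈ K → b ∈ K → G.Adj (f i) a → G.Adj (f (i + 2)) b → a = b :=
    fun i a b ha hb hia hib => eq_of_adj_succ_succ hinj hadj hmax hc hK hKf ha hb hia hib
  -- `Y`, `Y + 1` and the translates by 2 of the bad elements are disjoint, so `2|Y| + #bad ≤ c ≤
  -- |Y| + 4`, while `|Y| ≥ 3`.
  have hbad : #{y ∈ Y | y + 2 ∉ Y} ≤ 1 := by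
    have hd1 : Disjoint Y (Y.image (· + 1)) := by
      rw [Finset.disjoint_left]
      intro i hi hi'
      obtain ⟨j, hj, rfl⟩ := Finset.mem_image.1 hi'
      exact hsucc j hj hi
    have hd2 : Disjoint (Y ∪ Y.image (· + 1)) (({y ∈ Y | y + 2 ∉ Y} : Finset _).image (· + 2)) := by
      rw [Finset.disjoint_right]
      intro i hi hi'
      obtain ⟨j, hj, rfl⟩ := Finset.mem_image.1 hi
      rw [Finset.mem_filter] at hj
      rcases Finset.mem_union.1 hi' with h | h
      · exact hj.2 h
      · obtain ⟨k, hk, hkj⟩ := Finset.mem_image.1 h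
        have : k = j + 1 := by linear_combination hkj
        exact hsucc j hj.1 (this ▸ hk)
    have h := Finset.card_le_univ
      ((Y ∪ Y.image (· + 1)) ∪ (({y ∈ Y | y + 2 ∉ Y} : Finset _).image (· + 2)))
    rw [Finset.card_union_of_disjoint hd2, Finset.card_union_of_disjoint hd1, card_image_add,
      card_image_add, ZMod.card] at h
    omega
  -- all attachments have the same neighbours in `K`
  have hexit : ∀ y ∈ Y, ∀ y' ∈ Y, (¬ ∀ k ∈ K, (G.Adj (f y) k ↔ G.Adj (f y') k)) →
      ∃ b ∈ ({y ∈ Y | y + 2 ∉ Y} : Finset _), ∀ k ∈ K, (G.Adj (f b) k ↔ G.Adj (f y) k) := by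
    intro y hy y' hy' hne
    by_contra! hno
    -- Without an exit, steps of length two carry the neighbourhood of `f y` in `K` around the whole
    -- cycle.
    have hcl : ∀ j, (j ∈ Y ∧ ∀ k ∈ K, (G.Adj (f j) k ↔ G.Adj (f y) k)) ∨
        (j - 1 ∈ Y ∧ ∀ k ∈ K, (G.Adj (f (j - 1)) k ↔ G.Adj (f y) k)) := by
      refine zmod_induction (i := y) (Or.inl ⟨hy, fun _ _ => Iff.rfl⟩) ?_
      rintro j (⟨hj, hjk⟩ | ⟨hj, hjk⟩)
      · exact Or.inr (by simpa using ⟨hj, hjk⟩)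
      · have e : j - 1 + 2 = j + 1 := by ring
        have hj2 : j + 1 ∈ Y := by
          by_contra hj2
          obtain ⟨k, hk, hk'⟩ := hno (j - 1) (Finset.mem_filter.2 ⟨hj, by rwa [e]⟩)
          have := hjk k hk
          tauto
        refine Or.inl ⟨hj2, fun k hk => ?_⟩
        rw [← hjk k hk]
        obtain ⟨a, ha, hja⟩ := (memY _).1 hj
        obtain ⟨b, hb, hjb⟩ := (memY _).1 hj2
        have hs := fun a b ha hb h1 h2 => hssucc (j - 1) a b ha hb h1 (by rwa [e])
        constructor
        · intro h
          rw [← hs a k ha hk hja h, hs a b ha hb hja hjb, ← hs a b ha hb hja hjb]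
          exact hja
        · intro h
          rw [hs k b hk hb h hjb]
          exact hjb
    rcases hcl y' with ⟨-, h⟩ | ⟨h, -⟩
    · exact hne fun k hk => (h k hk).symm
    · exact hsucc _ h (by simpa using hy')
  have hmono : ∀ y ∈ Y, ∀ y' ∈ Y, ∀ k ∈ K, (G.Adj (f y) k ↔ G.Adj (f y') k) := by
    intro y hy y' hy'
    by_contra hne
    -- Two different neighbourhoods would each need their own bad element, but there is at most one.
    obtain ⟨b, hb, hbk⟩ := hexit y hy y' hy' hne
    obtain ⟨b', hb', hbk'⟩ := hexit y' hy' y hy (fun h => hne fun k hk => (h k hk).symm)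
    obtain rfl := Finset.card_le_one.1 hbad b hb b' hb'
    exact hne fun k hk => (hbk k hk).symm.trans (hbk' k hk)
  obtain ⟨y, hy, hy2⟩ : ∃ y ∈ Y, y + 2 ∈ Y := by
    by_contra! h
    rw [Finset.filter_true_of_mem h] at hbad
    omega
  obtain ⟨t, ht, hyt⟩ := (memY _).1 hy
  have honly : ∀ i, ∀ k ∈ K, G.Adj (f i) k → k = t := by
    intro i k hk hik
    have hi : i ∈ Y := (memY i).2 ⟨k, hk, hik⟩
    exact (hssucc y k t hk ht ((hmono i hi y hy k hk).1 hik)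
      ((hmono y hy _ hy2 t ht).1 hyt))
  -- `t` now separates the rest of `K` from the cycle.
  obtain ⟨k₀, hk₀, hk₀t⟩ := Finset.exists_mem_ne
    (lt_of_lt_of_le (by omega : 1 < #T) (Finset.card_le_card hTK)) t
  have hcut := hG.connOn_compl (R := {t}) (by simp)
  obtain ⟨x, hx, z, -, hxK, hzK, hxz⟩ := hcut.exists_adj (A := K) (by simpa using hk₀t) hk₀
    (b := f 0) (by simp; rintro rfl; exact hKf 0 ht) (hKf 0)
  obtain ⟨j, rfl⟩ := hnb x hxK z hzK hxz
  exact (Finset.mem_compl.1 hx) (by simpa using honly j x hxK hxz.symm)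

end LongestCycleLargestBond

end SimpleGraph

/-! ### Assembling the two cases. -/

theorem theorem1p4 {V : Type*} [Fintype V] (G : SimpleGraph V) (hG : G.IsKConnected 3)
    (h : (G.circumference : ℤ) ≥ (Fintype.card V : ℤ) - 3 ∨
      (G.maxBondSize : ℤ) ≥ (G.edgeSet.ncard : ℤ) - (Fintype.card V : ℤ) - 1)
    {u : V} (C : G.Walk u u) (hC : G.IsLongestCycle C)
    (B : Set (Sym2 V)) (hB : G.IsLargestBond B) :
    ∃ e : Sym2 V, e ∈ C.edges ∧ e ∈ B := by
  classical
  by_contra! hno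
  have hconn : G.ConnOn Finset.univ := by simpa using hG.connOn_compl (R := ∅) (by simp)
  have hc := hC.1.three_le_length
  have : NeZero C.length := ⟨by omega⟩
  obtain ⟨f, hinj, hedge⟩ := hC.1.exists_cycleMap rfl
  have hadj : ∀ i, G.Adj (f i) (f (i + 1)) := fun i => C.adj_of_mem_edges (hedge i)
  have hcirc : G.circumference = C.length := by
    refine IsGreatest.csSup_eq ⟨⟨u, C, hC.1, rfl⟩, ?_⟩
    rintro l ⟨v, D, hD, rfl⟩
    exact hC.2 v D hD
  have hbond : G.maxBondSize = B.ncard := by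
    refine IsGreatest.csSup_eq ⟨⟨B, hB.1, rfl⟩, ?_⟩
    rintro l ⟨A, hA, rfl⟩
    exact hB.2 A hA
  obtain ⟨S, rfl, hS1, hS2, hSmax⟩ := hB.exists_sides hconn
  rw [hcirc, hbond, SimpleGraph.ncard_edgeCut] at h
  -- By symmetry of the cut, `T` may be whichever side misses `f 0`.
  suffices main : ∀ T : Finset V, G.ConnOn T → G.ConnOn Tᶜ → G.pairs S Sᶜ = G.pairs Tᶜ T →
      G.edgeCut (S : Set V) = G.edgeCut (T : Set V) → f 0 ∉ T → False by
    by_cases h0 : f 0 ∈ S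
    · exact main Sᶜ hS2 (by simpa using hS1) (by simp)
        (by rw [Finset.coe_compl, SimpleGraph.edgeCut_compl]) (by simpa using h0)
    · exact main S hS1 hS2 (SimpleGraph.pairs_comm _ _) rfl h0
  intro T hT hTc hpairs hcut h0
  rw [hpairs] at h hSmax
  have hTf : ∀ j, f j ∉ T := SimpleGraph.zmod_induction h0 fun j hj hj1 =>
    hno _ (hedge j) (hcut ▸ SimpleGraph.mk_mem_edgeCut.2
      ⟨hadj j, Or.inr ⟨by simpa using hj, by simpa using hj1⟩⟩)
  rcases h with h | h
  · have := SimpleGraph.card_lt_of_side_disjoint_cycle hG hinj hadj hC.2 hc hT hSmax hTf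
    omega
  · have h1 := SimpleGraph.two_mul_card_lt_pairs_add_pairs hG hinj hadj hC.2 hc hT hTc hSmax hTf
    have h2 := G.two_mul_ncard_edgeSet
    rw [← Finset.union_compl T, SimpleGraph.pairs_union_left disjoint_compl_right,
      SimpleGraph.pairs_union_right disjoint_compl_right,
      SimpleGraph.pairs_union_right disjoint_compl_right, SimpleGraph.pairs_comm T Tᶜ] at h2
    omega
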